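/- Let $H$ and $U$ be complex Hilbert spaces (inner products conjugate linear in the second argument), let $A:D(A)\subset H\to H$ be the generator of a $C_0$-semigroup $(S(t))_{t\ge 0}$ on $H$, and let $B\in\mathcal L(U,D(A^*)')$, where $D(A^*)$ carries the graph norm and $D(A^*)'$ is its anti-dual (the continuous conjugate linear forms). Let $B^*\in\mathcal L(D(A^*),U)$ be the adjoint of $B$, i.e. $\langle u,B^*z\rangle_U=\langle Bu,z\rangle_{D(A^*)',D(A^*)}$. For $\tau>0$ and $z^1\in D(A^*)$, the solution on $[0,\tau]$ of the adjoint system $-z'(t)=A^*z(t)$, $z(\tau)=z^1$, is $z(t)=S(\tau-t)^*z^1\in D(A^*)$. Assume that $H$ is an admissible subspace for $(A,B)$: for every $\tau>0$ there is $C>0$ such that $\int_0^\tau\|B^*z(t)\|_U^2\,dt\le C\|z^1\|_H^2$ for every $z^1\in D(A^*)$, where $z$ is the solution of the adjoint system on $[0,\tau]$. Assume that $(A,B)$ satisfies the Fattorini–Hautus test $$\ker(\lambda-A^*)\cap\ker B^*=\{0\}\qquad\text{for all }\lambda\in\mathbb C .$$ Assume in addition that there is $T_0>0$ such that, for every $T>T_0$,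 the following two properties hold, where $z$ denotes the solution of the adjoint system with $\tau=T$ and $z(T)=z^1$. (i) There exist two complex Banach spaces $E_1,E_2$, a compact operator $P:E_1\to E_2$, a linear operator $L:D(A^*)\to E_1$ and $C>0$ such that, for every $z^1\in D(A^*)$, $$\|z(0)\|_H^2\le C\Big(\int_0^T\|B^*z(t)\|_U^2\,dt+\|PLz^1\|_{E_2}^2\Big),\qquad \|Lz^1\|_{E_1}^2\le C\Big(\|z(0)\|_H^2+\int_0^T\|B^*z(t)\|_U^2\,dt\Big).$$ (ii) For every $0<t_1<t_2<T-T_0$ there exists $C>0$ such that, for every $z^1\in D(A^*)$, $$\|z(t_2)\|_H^2\le C\Big(\|z(t_1)\|_H^2+\int_{t_1}^{t_2}\|B^*z(t)\|_U^2\,dt\Big).$$ Then, for every $T>T_0$, the system $y'=Ay+Bu$ is null controllable in time $T$: for every $y^0\in H$ there exist $u\in L^2(0,T;U)$ and $y\in C^0([0,T];H)$ with $y(T)=0$ such that, for every $\tau\in(0,T]$ and $z^1\in D(A^*)$, with $z(t)=S(\tau-t)^*z^1$, $$\langle y(\tau),z^1\rangle_H-\langle y^0,z(0)\rangle_H=\int_0^\tau\langle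 u(t),B^*z(t)\rangle_U\,dt .$$ -/

import Mathlib

open Set Filter Topology MeasureTheory
open scoped NNReal

universe uH uU w₁ w₂

noncomputable section

/-- The anti-dual of a complex normed space: its continuous conjugate-linear forms. -/
abbrev AntiDual (E : Type*) [NormedAddCommGroup E] [NormedSpace ℂ E] : Type _ :=
  E →L⋆[ℂ] ℂ

/-- A `C₀`-semigroup of bounded linear operators on a complex Hilbert space. -/
structure C0Semigroup (H : Type*) [NormedAddCommGroup H] [InnerProductSpace ℂ H] where
  /-- The operator at time `t ≥ 0`. -/
  op : ℝ≥0 → H →L[ℂ] H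
  op_zero : op 0 = ContinuousLinearMap.id ℂ H
  op_add : ∀ s t : ℝ≥0, op (s + t) = (op s).comp (op t)
  continuous_op : ∀ x : H, Continuous fun t : ℝ≥0 => op t x

/-- `A` (with its domain) is the infinitesimal generator of `S`: `x ∈ D(A)` and `A x = y`
exactly when `(S(t) x - x) / t → y` as `t → 0⁺`. -/
def C0Semigroup.IsGenerator {H : Type*} [NormedAddCommGroup H] [InnerProductSpace ℂ H]
    (S : C0Semigroup H) (A : H →ₗ.[ℂ] H) : Prop :=
  ∀ x y : H, (x, y) ∈ A.graph ↔
    Tendsto (fun t : ℝ≥0 => ((t : ℝ) : ℂ)⁻¹ • (S.op t x - x)) (𝓝[>] 0) (𝓝 y)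

/-- The domain of an unbounded operator, as a space of its own (to carry the graph norm, and not
the norm of the ambient space). -/
def GraphDomain {H : Type*} [NormedAddCommGroup H] [InnerProductSpace ℂ H]
    (A : H →ₗ.[ℂ] H) : Type _ := A.domain

namespace GraphDomain

variable {H : Type*} [NormedAddCommGroup H] [InnerProductSpace ℂ H] (A : H →ₗ.[ℂ] H)

instance : AddCommGroup (GraphDomain A) := inferInstanceAs (AddCommGroup A.domain)

instance : Module ℂ (GraphDomain A) := inferInstanceAs (Module ℂ A.domain)

/-- The inclusion `D(A) → H`. -/
def val : GraphDomain A →ₗ[ℂ] H := A.domain.subtype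

/-- The operator `A`, as a linear map `D(A) → H`. -/
def app : GraphDomain A →ₗ[ℂ] H := A.toFun

/-- The embedding `z ↦ (z, A z)` of the domain in the Hilbert space `H × H`. -/
def toGraph : GraphDomain A →ₗ[ℂ] WithLp 2 (H × H) :=
  (WithLp.linearEquiv 2 ℂ (H × H)).symm.toLinearMap ∘ₗ (val A).prod (app A)

theorem toGraph_injective : Function.Injective (toGraph A) := by
  intro x y hxy
  have h : (val A x, app A x) = (val A y, app A y) :=
    (WithLp.linearEquiv 2 ℂ (H × H)).symm.injective hxy
  exact Subtype.ext (congrArg Prod.fst h)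

/-- The graph norm. -/
instance : NormedAddCommGroup (GraphDomain A) :=
  NormedAddCommGroup.induced (GraphDomain A) (WithLp 2 (H × H)) (toGraph A) (toGraph_injective A)

instance : NormedSpace ℂ (GraphDomain A) :=
  NormedSpace.induced ℂ (GraphDomain A) (WithLp 2 (H × H)) (toGraph A)

theorem norm_sq (z : GraphDomain A) : ‖z‖ ^ 2 = ‖val A z‖ ^ 2 + ‖app A z‖ ^ 2 :=
  WithLp.prod_norm_sq_eq_of_L2 (toGraph A z)

end GraphDomain

/-- A semigroup leaves the domain of its generator invariant and commutes with it there. -/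
theorem C0Semigroup.IsGenerator.op_mem_graph {H : Type*} [NormedAddCommGroup H]
    [InnerProductSpace ℂ H] {S : C0Semigroup H} {A : H →ₗ.[ℂ] H}
    (hA : S.IsGenerator A) (t : ℝ≥0) {x y : H} (hxy : (x, y) ∈ A.graph) :
    (S.op t x, S.op t y) ∈ A.graph := by
  rw [hA] at hxy ⊢
  refine (((S.op t).continuous.tendsto y).comp hxy).congr fun h => ?_
  have h1 : S.op h (S.op t x) = S.op t (S.op h x) := by
    rw [← ContinuousLinearMap.comp_apply, ← ContinuousLinearMap.comp_apply, ← S.op_add,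
      ← S.op_add, add_comm]
  simp only [Function.comp_apply, h1, map_smul, map_sub]

section Control

variable {H : Type*} [NormedAddCommGroup H] [InnerProductSpace ℂ H] [CompleteSpace H]
variable {U : Type*} [NormedAddCommGroup U] [InnerProductSpace ℂ U] [CompleteSpace U]

/-- The adjoint semigroup leaves the domain of the adjoint `A*` invariant. -/
theorem C0Semigroup.IsGenerator.adjoint_op_mem {S : C0Semigroup H} {A : H →ₗ.[ℂ] H}
    (hA : S.IsGenerator A) (t : ℝ≥0) {z : H} (hz : z ∈ A.adjoint.domain) :
    ContinuousLinearMap.adjoint (S.op t) z ∈ A.adjoint.domain := by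
  rw [LinearPMap.mem_adjoint_domain_iff] at hz ⊢
  have key : ∀ x : A.domain, ∃ h : S.op t x ∈ A.domain, A ⟨S.op t x, h⟩ = S.op t (A x) := by
    intro x
    have h1 := hA.op_mem_graph t (A.mem_graph x)
    obtain ⟨w, hw1, hw2⟩ := (LinearPMap.mem_graph_iff A).1 h1
    simp only at hw1 hw2
    refine ⟨hw1 ▸ w.2, ?_⟩
    rw [← hw2]
    congr 1
    exact Subtype.ext hw1.symm
  choose h1 h2 using key
  have hc : Continuous fun x : A.domain => (⟨S.op t x, h1 x⟩ : A.domain) :=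
    ((S.op t).continuous.comp continuous_subtype_val).subtype_mk _
  refine (hz.comp hc).congr fun x => ?_
  change inner ℂ z (A ⟨S.op t x, h1 x⟩) =
    inner ℂ (ContinuousLinearMap.adjoint (S.op t) z) (A x)
  rw [h2, ContinuousLinearMap.adjoint_inner_left]

/-- The solution at time `t ∈ [0, τ]` of the adjoint system `-z' = A* z` on `(0, τ)`,
`z(τ) = z¹ ∈ D(A*)`, that is `z(t) = S(τ - t)* z¹ ∈ D(A*)`. -/
def adjointState {S : C0Semigroup H} {A : H →ₗ.[ℂ] H} (hA : S.IsGenerator A) (τ : ℝ)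
    (z₁ : GraphDomain A.adjoint) (t : ℝ) : GraphDomain A.adjoint :=
  ⟨ContinuousLinearMap.adjoint (S.op (τ - t).toNNReal) (GraphDomain.val A.adjoint z₁),
    hA.adjoint_op_mem _ z₁.2⟩

/-- The adjoint `B* : D(A*) → U` of a control operator `B : U → D(A*)'`. -/
def controlAdjoint {D : Type*} [NormedAddCommGroup D] [NormedSpace ℂ D]
    (B : U →L[ℂ] AntiDual D) : D →L[ℂ] U :=
  ((InnerProductSpace.toDual ℂ U).symm.toContinuousLinearEquiv :
    StrongDual ℂ U →L⋆[ℂ] U).comp B.flip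

/-- The defining property of `B*`. Mathlib's inner product is conjugate linear in its *first*
argument, so this is `⟨u, B* z⟩ = ⟨B u, z⟩` for an inner product that is conjugate linear in the
second one; all inner products below are likewise written with their arguments exchanged. -/
theorem inner_controlAdjoint {D : Type*} [NormedAddCommGroup D] [NormedSpace ℂ D]
    (B : U →L[ℂ] AntiDual D) (z : D) (u : U) : inner ℂ (controlAdjoint B z) u = B u z :=
  InnerProductSpace.toDual_symm_apply

/-- `H` is an admissible subspace for `(A, B)`. -/
def IsAdmissible {S : C0Semigroup H} {A : H →ₗ.[ℂ] H} (hA : S.IsGenerator A)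
    (B : U →L[ℂ] AntiDual (GraphDomain A.adjoint)) : Prop :=
  ∀ τ : ℝ, 0 < τ → ∃ C : ℝ, 0 < C ∧ ∀ z₁ : GraphDomain A.adjoint,
    ∫ t in (0 : ℝ)..τ, ‖controlAdjoint B (adjointState hA τ z₁ t)‖ ^ 2
      ≤ C * ‖GraphDomain.val A.adjoint z₁‖ ^ 2

/-- The Fattorini–Hautus test: `ker(μ - A*) ∩ ker B* = {0}` for every complex `μ`. -/
def FattoriniHautus (A : H →ₗ.[ℂ] H) (B : U →L[ℂ] AntiDual (GraphDomain A.adjoint)) : Prop :=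
  ∀ μ : ℂ, LinearMap.ker (μ • GraphDomain.val A.adjoint - GraphDomain.app A.adjoint) ⊓
    LinearMap.ker (controlAdjoint B).toLinearMap = ⊥

/-- `y ∈ C⁰([0, T]; H)` is a solution of `y' = A y + B u`, `y(0) = y₀`, on `(0, T)`. -/
def IsControlSolution {S : C0Semigroup H} {A : H →ₗ.[ℂ] H} (hA : S.IsGenerator A)
    (B : U →L[ℂ] AntiDual (GraphDomain A.adjoint)) (T : ℝ) (y₀ : H) (u : ℝ → U) (y : ℝ → H) :
    Prop :=
  ContinuousOn y (Icc 0 T) ∧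
    ∀ τ ∈ Ioc 0 T, ∀ z₁ : GraphDomain A.adjoint,
      inner ℂ (GraphDomain.val A.adjoint z₁) (y τ)
          - inner ℂ (GraphDomain.val A.adjoint (adjointState hA τ z₁ 0)) y₀
        = ∫ t in (0 : ℝ)..τ, inner ℂ (controlAdjoint B (adjointState hA τ z₁ t)) (u t)

/-- `(A, B)` is null controllable in time `T`: every initial state is steered to `0` at time `T`
by a control in `L²(0, T; U)`. -/
def IsNullControllable {S : C0Semigroup H} {A : H →ₗ.[ℂ] H} (hA : S.IsGenerator A)
    (B : U →L[ℂ] AntiDual (GraphDomain A.adjoint)) (T : ℝ) : Prop :=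
  ∀ y₀ : H, ∃ u : ℝ → U, MemLp u 2 (volume.restrict (Ioo 0 T)) ∧
    ∃ y : ℝ → H, IsControlSolution hA B T y₀ u y ∧ y T = 0

end Control

end

/-! By duality, null controllability in time `T` follows from an observability inequality: `S(T)* z`
is bounded in norm by the output `B* S(·)* z` in `L²(0, T; U)`, for `z` in `D(A*)`. Time is counted
backwards from the final datum, so that the adjoint state is `S(s)* z`.

Observability is a compactness-uniqueness argument. Fix `r` between `T₀` and `T`. By (i) at time
`r`, a bounded sequence of states `S(r)* zₙ` whose outputs on `(0, r)` tend to zero has a convergent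
subsequence. The limits of such states, now with outputs tending to zero on `(0, t)`, form a closed
subspace `N_t` (`asymptoticKernel`). For `t ≥ r` its unit ball is compact, so its dimension is
finite; if `N_T = 0`, normalisation and compactness give the inequality.

To see that `N_T = 0` (`asymptoticKernel_eq_bot`): `N_t` decreases in `t`, so its dimension is
constant on some interval inside `(r, T)`. As `S(σ)*` maps `N_{t+σ}` into `N_t`, that common space
is invariant for small `σ`. If nonzero it contains an eigenvector of `A*` (`exists_eigenvector`),
whose output vanishes on a short interval by admissibility. This contradicts the Fattorini–Hautus
test. -/

noncomputable section

/-! ### The integrated semigroup -/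

namespace C0Semigroup

section Primitive

variable {H : Type*} [NormedAddCommGroup H] [InnerProductSpace ℂ H]
  (S : C0Semigroup H)

theorem op_add_apply (s t : ℝ≥0) (x : H) : S.op (s + t) x = S.op s (S.op t x) := by
  rw [S.op_add]; rfl

theorem op_comm_apply (s t : ℝ≥0) (x : H) : S.op s (S.op t x) = S.op t (S.op s x) := by
  rw [← op_add_apply, ← op_add_apply, add_comm]

theorem continuous_op_toNNReal (x : H) : Continuous fun s : ℝ => S.op s.toNNReal x :=
  (S.continuous_op x).comp continuous_real_toNNReal

theorem intervalIntegrable_op (x : H) (a b : ℝ) :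
    IntervalIntegrable (fun s : ℝ => S.op s.toNNReal x) volume a b :=
  (S.continuous_op_toNNReal x).intervalIntegrable a b

variable [CompleteSpace H]

theorem exists_norm_op_le (T : ℝ≥0) : ∃ M : ℝ, 0 < M ∧ ∀ t ≤ T, ‖S.op t‖ ≤ M := by
  obtain ⟨C, hC⟩ := banach_steinhaus (g := fun t : Icc (0 : ℝ≥0) T => S.op t) fun x => by
    obtain ⟨C, hC⟩ := (isCompact_Icc (a := (0 : ℝ≥0)) (b := T)).exists_bound_of_continuousOn
      (S.continuous_op x).continuousOn
    exact ⟨C, fun i => hC i i.2⟩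
  exact ⟨max C 1, by positivity, fun t ht => (hC ⟨t, zero_le, ht⟩).trans (le_max_left _ _)⟩

/-- The integrated semigroup `x ↦ ∫₀ʰ S(s) x ds`. -/
def primitive (h : ℝ≥0) : H →L[ℂ] H :=
  LinearMap.mkContinuousOfExistsBound
    { toFun := fun x => ∫ s in (0 : ℝ)..h, S.op s.toNNReal x
      map_add' := fun x y => by
        simp only [map_add]
        exact intervalIntegral.integral_add (S.intervalIntegrable_op x _ _)
          (S.intervalIntegrable_op y _ _)
      map_smul' := fun c x => by simp }
    (by
      obtain ⟨M, hM, hb⟩ := S.exists_norm_op_le h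
      refine ⟨M * |(h : ℝ) - 0|, fun x => ?_⟩
      rw [mul_right_comm]
      refine intervalIntegral.norm_integral_le_of_norm_le_const fun s hs => ?_
      rw [uIoc_of_le h.coe_nonneg] at hs
      exact (S.op s.toNNReal).le_of_opNorm_le (hb _ (Real.toNNReal_le_iff_le_coe.2 hs.2)) x)

theorem primitive_apply (h : ℝ≥0) (x : H) :
    S.primitive h x = ∫ s in (0 : ℝ)..h, S.op s.toNNReal x := rfl

theorem op_primitive (t h : ℝ≥0) (x : H) : S.op t (S.primitive h x) = S.primitive h (S.op t x) := by
  rw [primitive_apply, primitive_apply,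
    ← ContinuousLinearMap.intervalIntegral_comp_comm _ (S.intervalIntegrable_op x _ _)]
  simp only [S.op_comm_apply t]

theorem primitive_op (h t : ℝ≥0) (x : H) :
    S.primitive h (S.op t x) = S.primitive (h + t) x - S.primitive t x := by
  have h1 : S.primitive h (S.op t x) = ∫ s in (0 : ℝ)..h, S.op (s + t).toNNReal x := by
    rw [primitive_apply]
    refine intervalIntegral.integral_congr fun s hs => ?_
    rw [uIcc_of_le h.coe_nonneg] at hs
    simp only [Real.toNNReal_add hs.1 t.coe_nonneg, Real.toNNReal_coe, op_add_apply]
  rw [h1, intervalIntegral.integral_comp_add_right (fun s : ℝ => S.op s.toNNReal x), zero_add,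
    primitive_apply, primitive_apply, intervalIntegral.integral_interval_sub_left
      (S.intervalIntegrable_op x _ _) (S.intervalIntegrable_op x _ _), NNReal.coe_add]

/-- Both sides equal the primitive at `h + t` minus those at `h` and `t`. This symmetry turns
difference quotients of the primitive into averages of the semigroup. -/
theorem primitive_sub_comm (h t : ℝ≥0) (x : H) :
    S.primitive h (S.op t x - x) = S.primitive t (S.op h x - x) := by
  rw [map_sub, map_sub, primitive_op, primitive_op, add_comm]
  abel

theorem tendsto_inv_smul_primitive (x : H) :
    Tendsto (fun t : ℝ≥0 => ((t : ℝ) : ℂ)⁻¹ • S.primitive t x) (𝓝[>] 0) (𝓝 x) := by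
  have hd : HasDerivAt (fun t : ℝ => ∫ s in (0 : ℝ)..t, S.op s.toNNReal x)
      (S.op (0 : ℝ).toNNReal x) 0 :=
    intervalIntegral.integral_hasDerivAt_right (S.intervalIntegrable_op x _ _)
      (S.continuous_op_toNNReal x).stronglyMeasurable.stronglyMeasurableAtFilter
      (S.continuous_op_toNNReal x).continuousAt
  rw [hasDerivAt_iff_tendsto_slope_zero] at hd
  simp only [zero_add, intervalIntegral.integral_same, sub_zero, Real.toNNReal_zero, S.op_zero,
    ContinuousLinearMap.id_apply] at hd
  have hc : Tendsto (fun t : ℝ≥0 => (t : ℝ)) (𝓝[>] 0) (𝓝[≠] 0) := by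
    refine tendsto_nhdsWithin_iff.2 ⟨?_, ?_⟩
    · exact (NNReal.continuous_coe.tendsto 0).mono_left nhdsWithin_le_nhds
    · filter_upwards [self_mem_nhdsWithin] with t ht
      exact (NNReal.coe_pos.2 ht).ne'
  refine (hd.comp hc).congr fun t => ?_
  rw [Function.comp_apply, ← Complex.ofReal_inv, Complex.coe_smul, primitive_apply]

end Primitive

end C0Semigroup

/-! ### Density of the domains of `A` and `A*` -/

namespace C0Semigroup.IsGenerator

variable {H : Type*} [NormedAddCommGroup H] [InnerProductSpace ℂ H] [CompleteSpace H]
  {S : C0Semigroup H} {A : H →ₗ.[ℂ] H} (hA : S.IsGenerator A)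

include hA

theorem primitive_mem_graph (h : ℝ≥0) (x : H) : (S.primitive h x, S.op h x - x) ∈ A.graph := by
  rw [hA]
  refine (S.tendsto_inv_smul_primitive (S.op h x - x)).congr fun t => ?_
  rw [S.op_primitive, ← map_sub, S.primitive_sub_comm]

theorem primitive_apply_of_mem_graph (h : ℝ≥0) {x y : H} (hxy : (x, y) ∈ A.graph) :
    S.primitive h y = S.op h x - x := by
  rw [hA] at hxy
  refine tendsto_nhds_unique (((S.primitive h).continuous.tendsto y).comp hxy)
    ((S.tendsto_inv_smul_primitive (S.op h x - x)).congr fun t => ?_)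
  rw [Function.comp_apply, map_smul, S.primitive_sub_comm]

theorem dense_domain : Dense (A.domain : Set H) := by
  intro x
  refine mem_closure_of_tendsto (S.tendsto_inv_smul_primitive x) (Eventually.of_forall fun t => ?_)
  exact A.domain.smul_mem _ (LinearPMap.mem_domain_of_mem_graph (hA.primitive_mem_graph t x))

theorem inner_app_adjoint (z : GraphDomain A.adjoint) {x y : H} (hxy : (x, y) ∈ A.graph) :
    inner ℂ (GraphDomain.app A.adjoint z) x = inner ℂ (GraphDomain.val A.adjoint z) y := by
  obtain ⟨w, rfl, rfl⟩ := (LinearPMap.mem_graph_iff A).1 hxy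
  exact LinearPMap.adjoint_isFormalAdjoint hA.dense_domain z w

/-- An element of `D(A*)`, from its defining identity. -/
theorem exists_adjoint_domain {z w : H}
    (h : ∀ x y : H, (x, y) ∈ A.graph → inner ℂ w x = inner ℂ z y) :
    ∃ z' : GraphDomain A.adjoint, GraphDomain.val A.adjoint z' = z ∧
      GraphDomain.app A.adjoint z' = w := by
  have h' : ∀ x : A.domain, inner ℂ w (x : H) = inner ℂ z (A x) :=
    fun x => h _ _ (A.mem_graph x)
  have hz : z ∈ A.adjoint.domain := LinearPMap.mem_adjoint_domain_of_exists z ⟨w, h'⟩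
  exact ⟨⟨z, hz⟩, rfl, LinearPMap.adjoint_apply_eq hA.dense_domain ⟨z, hz⟩ h'⟩

/-- The adjoint of the integrated semigroup regularises any vector into `D(A*)`; this is the source
of all the elements of `D(A*)` built below. -/
theorem exists_adjoint_primitive (h : ℝ≥0) (z : H) :
    ∃ z' : GraphDomain A.adjoint,
      GraphDomain.val A.adjoint z' = ContinuousLinearMap.adjoint (S.primitive h) z ∧
      GraphDomain.app A.adjoint z' = ContinuousLinearMap.adjoint (S.op h) z - z := by
  refine hA.exists_adjoint_domain fun x y hxy => ?_
  rw [ContinuousLinearMap.adjoint_inner_left, hA.primitive_apply_of_mem_graph h hxy,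
    inner_sub_left, inner_sub_right, ContinuousLinearMap.adjoint_inner_left]

omit hA in
theorem inner_eq_zero_of_primitive {y v : H}
    (h : ∀ᶠ t in 𝓝[>] (0 : ℝ≥0), inner ℂ v (S.primitive t y) = 0) : inner ℂ v y = 0 := by
  refine tendsto_nhds_unique ((tendsto_const_nhds (x := v)).inner (𝕜 := ℂ)
    (S.tendsto_inv_smul_primitive y)) (tendsto_const_nhds.congr' ?_)
  filter_upwards [h] with t ht
  rw [inner_smul_right, ht, mul_zero]

/-- If `y` is orthogonal to `D(A*)`, it is orthogonal to the adjoint primitives of `y` itself.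
Dividing by `t` and letting `t → 0` gives `⟨y, y⟩ = 0`. -/
theorem denseRange_val : DenseRange (GraphDomain.val A.adjoint) := by
  have h : (LinearMap.range (GraphDomain.val A.adjoint)).topologicalClosure = ⊤ := by
    rw [Submodule.topologicalClosure_eq_top_iff, Submodule.eq_bot_iff]
    intro y hy
    rw [Submodule.mem_orthogonal] at hy
    refine (inner_self_eq_zero (𝕜 := ℂ)).1 (inner_eq_zero_of_primitive (S := S)
      (Eventually.of_forall fun t => ?_))
    obtain ⟨z, hz, -⟩ := hA.exists_adjoint_primitive t y
    rw [← ContinuousLinearMap.adjoint_inner_left, ← hz]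
    exact hy _ ⟨z, rfl⟩
  rw [DenseRange, ← LinearMap.coe_range, dense_iff_closure_eq,
    ← Submodule.topologicalClosure_coe, h, Submodule.top_coe]

end C0Semigroup.IsGenerator

/-- The primitive is locally Lipschitz in operator norm because the semigroup is locally bounded.
Norm continuity, unlike strong continuity, passes to adjoints. -/
theorem C0Semigroup.continuous_primitive {H : Type*} [NormedAddCommGroup H]
    [InnerProductSpace ℂ H] [CompleteSpace H] (S : C0Semigroup H) : Continuous S.primitive := by
  rw [continuous_iff_continuousAt]
  intro t
  obtain ⟨M, hM, hb⟩ := S.exists_norm_op_le (t + 1)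
  have hle : ∀ᶠ s in 𝓝 t, ‖S.primitive s - S.primitive t‖ ≤ M * |(s : ℝ) - t| := by
    filter_upwards [Iic_mem_nhds (lt_add_one t)] with s hs
    refine ContinuousLinearMap.opNorm_le_bound _ (by positivity) fun x => ?_
    rw [_root_.sub_apply, S.primitive_apply, S.primitive_apply,
      intervalIntegral.integral_interval_sub_left (S.intervalIntegrable_op x _ _)
      (S.intervalIntegrable_op x _ _), mul_right_comm]
    refine intervalIntegral.norm_integral_le_of_norm_le_const fun r hr => ?_
    refine (S.op r.toNNReal).le_of_opNorm_le (hb _ (Real.toNNReal_le_iff_le_coe.2 ?_)) x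
    exact (mem_uIoc.1 hr).elim (fun h => h.2.trans hs)
      fun h => h.2.trans (NNReal.coe_le_coe.2 (le_add_of_nonneg_right zero_le))
  rw [ContinuousAt, tendsto_iff_norm_sub_tendsto_zero]
  refine squeeze_zero' (Eventually.of_forall fun s => norm_nonneg _) hle ?_
  have : Continuous fun s : ℝ≥0 => M * |(s : ℝ) - t| := by fun_prop
  simpa using this.tendsto t

/-! ### The adjoint semigroup on `H` and on `D(A*)` -/

namespace C0Semigroup.IsGenerator

variable {H : Type*} [NormedAddCommGroup H] [InnerProductSpace ℂ H] [CompleteSpace H]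
  {S : C0Semigroup H} {A : H →ₗ.[ℂ] H} (hA : S.IsGenerator A)

include hA

theorem adjoint_op_sub (t : ℝ≥0) (z : GraphDomain A.adjoint) :
    ContinuousLinearMap.adjoint (S.op t) (GraphDomain.val A.adjoint z) -
        GraphDomain.val A.adjoint z =
      ContinuousLinearMap.adjoint (S.primitive t) (GraphDomain.app A.adjoint z) := by
  refine ext_inner_right ℂ fun x => ?_
  rw [ContinuousLinearMap.adjoint_inner_left,
    hA.inner_app_adjoint z (hA.primitive_mem_graph t x),
    inner_sub_left, inner_sub_right, ContinuousLinearMap.adjoint_inner_left]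

/-- On `D(A*)` the orbit is `z` plus the adjoint primitive applied to `A* z`, hence continuous.
Density and local boundedness extend this to `H` by locally uniform approximation. -/
theorem continuous_adjoint_op (z : H) :
    Continuous fun t : ℝ≥0 => ContinuousLinearMap.adjoint (S.op t) z := by
  refine continuous_of_locally_uniform_approx_of_continuousAt fun t u hu => ?_
  obtain ⟨ε, hε, hu⟩ := Metric.mem_uniformity_dist.1 hu
  obtain ⟨M, hM, hb⟩ := S.exists_norm_op_le (t + 1)
  obtain ⟨z', hz'⟩ := hA.denseRange_val.exists_dist_lt z (ε := ε / M) (by positivity)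
  refine ⟨Iic (t + 1), Iic_mem_nhds (lt_add_one t),
    fun s => ContinuousLinearMap.adjoint (S.op s) (GraphDomain.val A.adjoint z'), ?_, ?_⟩
  · have h : Continuous fun s : ℝ≥0 => ContinuousLinearMap.adjoint (S.primitive s)
        (GraphDomain.app A.adjoint z') + GraphDomain.val A.adjoint z' :=
      ((ContinuousLinearMap.adjoint.continuous.comp S.continuous_primitive).clm_apply
        continuous_const).add continuous_const
    refine h.continuousAt.congr (Eventually.of_forall fun s => ?_)
    simp only [← hA.adjoint_op_sub, sub_add_cancel]
  · intro s hs
    refine hu ?_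
    rw [dist_eq_norm, ← map_sub]
    rw [dist_eq_norm] at hz'
    calc _ ≤ M * ‖z - GraphDomain.val A.adjoint z'‖ :=
          ContinuousLinearMap.le_of_opNorm_le _ (by rw [LinearIsometryEquiv.norm_map]; exact hb s hs) _
      _ < M * (ε / M) := by gcongr
      _ = ε := by field_simp

/-- The adjoint semigroup. -/
def adjointSemigroup : C0Semigroup H where
  op t := ContinuousLinearMap.adjoint (S.op t)
  op_zero := by rw [S.op_zero, ContinuousLinearMap.adjoint_id]
  op_add s t := by rw [add_comm, S.op_add, ContinuousLinearMap.adjoint_comp]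
  continuous_op := hA.continuous_adjoint_op

theorem inner_adjointSemigroup (t : ℝ≥0) (x y : H) :
    inner ℂ (hA.adjointSemigroup.op t x) y = inner ℂ x (S.op t y) :=
  ContinuousLinearMap.adjoint_inner_left _ _ _

theorem exists_adjointSemigroup_app (t : ℝ≥0) (z : GraphDomain A.adjoint) :
    ∃ z' : GraphDomain A.adjoint,
      GraphDomain.val A.adjoint z' = hA.adjointSemigroup.op t (GraphDomain.val A.adjoint z) ∧
      GraphDomain.app A.adjoint z' = hA.adjointSemigroup.op t (GraphDomain.app A.adjoint z) := by
  refine hA.exists_adjoint_domain fun x y hxy => ?_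
  rw [inner_adjointSemigroup, inner_adjointSemigroup]
  exact hA.inner_app_adjoint z (hA.op_mem_graph t hxy)

omit hA [CompleteSpace H] in
theorem _root_.GraphDomain.val_injective (A : H →ₗ.[ℂ] H) : Function.Injective (GraphDomain.val A) :=
  Subtype.val_injective

/-- The adjoint semigroup on `D(A*)`. -/
def adjointEvol (t : ℝ≥0) : GraphDomain A.adjoint →ₗ[ℂ] GraphDomain A.adjoint :=
  LinearMap.restrict (p := A.adjoint.domain) (q := A.adjoint.domain)
    (hA.adjointSemigroup.op t).toLinearMap fun _ hz => hA.adjoint_op_mem t hz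

theorem val_adjointEvol (t : ℝ≥0) (z : GraphDomain A.adjoint) :
    GraphDomain.val A.adjoint (hA.adjointEvol t z) =
      hA.adjointSemigroup.op t (GraphDomain.val A.adjoint z) := rfl

theorem app_adjointEvol (t : ℝ≥0) (z : GraphDomain A.adjoint) :
    GraphDomain.app A.adjoint (hA.adjointEvol t z) =
      hA.adjointSemigroup.op t (GraphDomain.app A.adjoint z) := by
  obtain ⟨z', h1, h2⟩ := hA.exists_adjointSemigroup_app t z
  rw [← h2, GraphDomain.val_injective _ (h1.trans (hA.val_adjointEvol t z).symm)]

theorem adjointState_eq (τ t : ℝ) (z : GraphDomain A.adjoint) :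
    adjointState hA τ z t = hA.adjointEvol (τ - t).toNNReal z := rfl

theorem adjointEvol_add (s t : ℝ≥0) (z : GraphDomain A.adjoint) :
    hA.adjointEvol (s + t) z = hA.adjointEvol s (hA.adjointEvol t z) :=
  GraphDomain.val_injective _ (hA.adjointSemigroup.op_add_apply s t _)

theorem adjointEvol_zero (z : GraphDomain A.adjoint) : hA.adjointEvol 0 z = z := by
  refine GraphDomain.val_injective _ ?_
  rw [val_adjointEvol, op_zero, ContinuousLinearMap.id_apply]

theorem continuous_adjointEvol (z : GraphDomain A.adjoint) :
    Continuous fun t => hA.adjointEvol t z := by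
  have hi : IsInducing (GraphDomain.toGraph A.adjoint) := ⟨rfl⟩
  rw [hi.continuous_iff]
  refine (WithLp.prod_continuous_toLp 2 H H).comp
    (((hA.adjointSemigroup.continuous_op (GraphDomain.val A.adjoint z)).prodMk
    (hA.adjointSemigroup.continuous_op (GraphDomain.app A.adjoint z))).congr fun t => ?_)
  rw [← app_adjointEvol]; rfl

/-- A nonzero finite-dimensional subspace which the adjoint semigroup leaves invariant for small
times contains an eigenvector of `A*`. -/
theorem exists_eigenvector (V : Submodule ℂ H) [FiniteDimensional ℂ V] (hV : V ≠ ⊥) {δ : ℝ≥0}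
    (hδ : 0 < δ) (hinv : ∀ t ≤ δ, ∀ v ∈ V, hA.adjointSemigroup.op t v ∈ V) :
    ∃ (z : GraphDomain A.adjoint) (μ : ℂ), z ≠ 0 ∧ GraphDomain.val A.adjoint z ∈ V ∧
      GraphDomain.app A.adjoint z = μ • GraphDomain.val A.adjoint z := by
  -- `W` is the part of `D(A*)` on which `A*` acts inside `V`. It will be shown to fill `V`, so that
  -- `A*` induces an endomorphism of a finite-dimensional space.
  set W : Submodule ℂ (GraphDomain A.adjoint) :=
    V.comap (GraphDomain.val A.adjoint) ⊓ V.comap (GraphDomain.app A.adjoint)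
  have hprim : ∀ t ≤ δ, ∀ v ∈ V, ContinuousLinearMap.adjoint (S.primitive t) v ∈ V := by
    intro t ht v hv
    -- Passing to the double orthogonal reduces the claim to integrating scalars `⟨S(s)* v, y⟩`,
    -- which vanish for `y` orthogonal to `V`.
    rw [← V.orthogonal_orthogonal, Submodule.mem_orthogonal']
    intro y hy
    rw [ContinuousLinearMap.adjoint_inner_left, S.primitive_apply,
      ← innerSL_apply_apply ℂ, ← ContinuousLinearMap.intervalIntegral_comp_comm _
        (S.intervalIntegrable_op y _ _)]
    refine intervalIntegral.integral_zero_ae (Eventually.of_forall fun s hs => ?_)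
    rw [uIoc_of_le t.coe_nonneg] at hs
    rw [innerSL_apply_apply, ← hA.inner_adjointSemigroup]
    exact hy _ (hinv _ ((Real.toNNReal_le_iff_le_coe.2 hs.2).trans ht) v hv)
  have hWV : W.map (GraphDomain.val A.adjoint) = V := by
    have hle : W.map (GraphDomain.val A.adjoint) ≤ V := Submodule.map_le_iff_le_comap.2 inf_le_left
    have : FiniteDimensional ℂ (W.map (GraphDomain.val A.adjoint)) :=
      Submodule.finiteDimensional_of_le hle
    -- It remains to kill a `y ∈ V` orthogonal to the image of `W`. Its adjoint primitives for small
    -- times lie in that image, so the averaging argument used for density applies.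
    rw [← Submodule.sup_orthogonal_inf_of_hasOrthogonalProjection hle, eq_comm, sup_eq_left]
    intro y hy
    rw [Submodule.mem_inf, Submodule.mem_orthogonal] at hy
    suffices y = 0 by rw [this]; exact zero_mem _
    refine (inner_self_eq_zero (𝕜 := ℂ)).1 (inner_eq_zero_of_primitive (S := S) ?_)
    filter_upwards [nhdsWithin_le_nhds (Iic_mem_nhds hδ)] with t ht
    obtain ⟨z, hz1, hz2⟩ := hA.exists_adjoint_primitive t y
    rw [← ContinuousLinearMap.adjoint_inner_left, ← hz1]
    refine hy.1 _ ⟨z, ⟨?_, ?_⟩, rfl⟩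
    · exact Submodule.mem_comap.2 (hz1 ▸ hprim t ht y hy.2)
    · exact Submodule.mem_comap.2 (hz2 ▸ V.sub_mem (hinv t ht y hy.2) hy.2)
  have hval : ∀ w : W, GraphDomain.val A.adjoint w ∈ V := fun w => w.2.1
  have happ : ∀ w : W, GraphDomain.app A.adjoint w ∈ V := fun w => w.2.2
  let e : W ≃ₗ[ℂ] V := LinearEquiv.ofBijective
    (((GraphDomain.val A.adjoint).comp W.subtype).codRestrict V hval)
    ⟨fun x y hxy => Subtype.ext (GraphDomain.val_injective _ (congrArg V.subtype hxy)), by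
      rintro ⟨v, hv⟩
      rw [← hWV] at hv
      obtain ⟨w, hw, rfl⟩ := hv
      exact ⟨⟨w, hw⟩, rfl⟩⟩
  let f : Module.End ℂ V :=
    (((GraphDomain.app A.adjoint).comp W.subtype).codRestrict V happ).comp e.symm.toLinearMap
  have : Nontrivial V := Submodule.nontrivial_iff_ne_bot.2 hV
  obtain ⟨μ, hμ⟩ := Module.End.exists_eigenvalue f
  obtain ⟨v, hv⟩ := hμ.exists_hasEigenvector
  have hev : GraphDomain.val A.adjoint (e.symm v) = v :=
    congrArg Subtype.val (e.apply_symm_apply v)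
  refine ⟨e.symm v, μ, ?_, hval _, ?_⟩
  · intro h0
    exact hv.2 (Subtype.ext (by rw [← hev, h0, map_zero, Submodule.coe_zero]))
  · rw [hev]
    exact congrArg Subtype.val hv.apply_eq_smul

end C0Semigroup.IsGenerator

/-! ### Output maps -/

section Observation

variable {H : Type*} [NormedAddCommGroup H] [InnerProductSpace ℂ H] [CompleteSpace H]
  {U : Type*} [NormedAddCommGroup U] [InnerProductSpace ℂ U] [CompleteSpace U]
  {S : C0Semigroup H} {A : H →ₗ.[ℂ] H} (hA : S.IsGenerator A)
  (B : U →L[ℂ] AntiDual (GraphDomain A.adjoint))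

/-- The output `s ↦ B* S(s)* z` of the adjoint system, for `z ∈ D(A*)`. -/
def output (z : GraphDomain A.adjoint) (s : ℝ) : U :=
  controlAdjoint B (hA.adjointEvol s.toNNReal z)

theorem continuous_output (z : GraphDomain A.adjoint) : Continuous (output hA B z) :=
  (controlAdjoint B).continuous.comp
    ((hA.continuous_adjointEvol z).comp continuous_real_toNNReal)

theorem controlAdjoint_adjointState (τ t : ℝ) (z : GraphDomain A.adjoint) :
    controlAdjoint B (adjointState hA τ z t) = output hA B z (τ - t) := rfl

theorem output_adjointEvol (σ : ℝ≥0) (z : GraphDomain A.adjoint) {s : ℝ} (hs : 0 ≤ s) :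
    output hA B (hA.adjointEvol σ z) s = output hA B z (s + σ) := by
  rw [output, output, ← hA.adjointEvol_add, Real.toNNReal_add hs σ.coe_nonneg,
    Real.toNNReal_coe]

theorem memLp_output (τ : ℝ) (z : GraphDomain A.adjoint) :
    MemLp ((Ioc 0 τ).indicator (output hA B z)) 2 volume := by
  rw [memLp_indicator_iff_restrict measurableSet_Ioc]
  obtain ⟨C, hC⟩ := (isCompact_Icc (a := (0 : ℝ)) (b := τ)).exists_bound_of_continuousOn
    (continuous_output hA B z).continuousOn
  refine MemLp.of_bound (continuous_output hA B z).aestronglyMeasurable C ?_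
  filter_upwards [ae_restrict_mem measurableSet_Ioc] with s hs
  exact hC s (Ioc_subset_Icc_self hs)

/-- The output map `z ↦ 1_{(0, τ]} B* S(·)* z` into `L²(ℝ; U)`. -/
def outputMap (τ : ℝ) : GraphDomain A.adjoint →ₗ[ℂ] Lp U 2 (volume : Measure ℝ) where
  toFun z := (memLp_output hA B τ z).toLp
  map_add' x y := by
    rw [← MemLp.toLp_add]
    refine MemLp.toLp_congr _ _ (Eventually.of_forall fun s => ?_)
    by_cases hs : s ∈ Ioc 0 τ <;> simp [hs, output]
  map_smul' c x := by
    rw [RingHom.id_apply, ← MemLp.toLp_const_smul]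
    refine MemLp.toLp_congr _ _ (Eventually.of_forall fun s => ?_)
    by_cases hs : s ∈ Ioc 0 τ <;> simp [hs, output]

theorem coeFn_outputMap (τ : ℝ) (z : GraphDomain A.adjoint) :
    outputMap hA B τ z =ᵐ[volume] (Ioc 0 τ).indicator (output hA B z) :=
  (memLp_output hA B τ z).coeFn_toLp

theorem inner_outputMap {τ : ℝ} (hτ : 0 ≤ τ) (z : GraphDomain A.adjoint)
    (v : Lp U 2 (volume : Measure ℝ)) :
    inner ℂ (outputMap hA B τ z) v = ∫ s in (0 : ℝ)..τ, inner ℂ (output hA B z s) (v s) := by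
  rw [L2.inner_def, intervalIntegral.integral_of_le hτ, ← integral_indicator measurableSet_Ioc]
  refine integral_congr_ae ?_
  filter_upwards [coeFn_outputMap hA B τ z] with s hs
  rw [hs]
  by_cases h : s ∈ Ioc 0 τ <;> simp [h]

theorem norm_outputMap_sq {τ : ℝ} (hτ : 0 ≤ τ) (z : GraphDomain A.adjoint) :
    ‖outputMap hA B τ z‖ ^ 2 = ∫ s in (0 : ℝ)..τ, ‖output hA B z s‖ ^ 2 := by
  have h := inner_outputMap hA B hτ z (outputMap hA B τ z)
  have h2 : ∫ s in (0 : ℝ)..τ, inner ℂ (output hA B z s) (outputMap hA B τ z s) =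
      ∫ s in (0 : ℝ)..τ, ((‖output hA B z s‖ ^ 2 : ℝ) : ℂ) := by
    rw [intervalIntegral.integral_of_le hτ, intervalIntegral.integral_of_le hτ]
    refine integral_congr_ae ?_
    filter_upwards [ae_restrict_mem measurableSet_Ioc,
      ae_restrict_of_ae (coeFn_outputMap hA B τ z)] with s hs hs'
    rw [hs', indicator_of_mem hs, inner_self_eq_norm_sq_to_K]
    push_cast; rfl
  rw [h2, intervalIntegral.integral_ofReal, inner_self_eq_norm_sq_to_K] at h
  refine Complex.ofReal_injective ?_
  rw [Complex.ofReal_pow]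
  exact h

theorem integral_adjointState {τ : ℝ} (hτ : 0 ≤ τ) (z : GraphDomain A.adjoint) :
    ∫ t in (0 : ℝ)..τ, ‖controlAdjoint B (adjointState hA τ z t)‖ ^ 2 =
      ‖outputMap hA B τ z‖ ^ 2 := by
  simp only [controlAdjoint_adjointState]
  rw [intervalIntegral.integral_comp_sub_left (fun s => ‖output hA B z s‖ ^ 2),
    norm_outputMap_sq hA B hτ, sub_self, sub_zero]

theorem intervalIntegrable_norm_output_sq (z : GraphDomain A.adjoint) (a b : ℝ) :
    IntervalIntegrable (fun s => ‖output hA B z s‖ ^ 2) volume a b :=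
  ((continuous_output hA B z).norm.pow 2).intervalIntegrable a b

/-- Evolving the datum by `σ` shifts its output, so the left side only sees the window `(σ, τ + σ)`.
-/
theorem norm_outputMap_adjointEvol_le {τ : ℝ} (hτ : 0 ≤ τ) (σ : ℝ≥0)
    (z : GraphDomain A.adjoint) :
    ‖outputMap hA B τ (hA.adjointEvol σ z)‖ ≤ ‖outputMap hA B (τ + σ) z‖ := by
  refine (sq_le_sq₀ (norm_nonneg _) (norm_nonneg _)).1 ?_
  have hσ := σ.coe_nonneg
  rw [norm_outputMap_sq hA B hτ, norm_outputMap_sq hA B (by positivity)]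
  have h : ∫ s in (0 : ℝ)..τ, ‖output hA B (hA.adjointEvol σ z) s‖ ^ 2 =
      ∫ s in (0 : ℝ)..τ, ‖output hA B z (s + σ)‖ ^ 2 :=
    intervalIntegral.integral_congr fun s hs => by
      rw [uIcc_of_le hτ] at hs
      simp only [output_adjointEvol hA B σ z hs.1]
  rw [h, intervalIntegral.integral_comp_add_right (fun s => ‖output hA B z s‖ ^ 2), zero_add]
  exact intervalIntegral.integral_mono_interval hσ (by linarith) le_rfl
    (Eventually.of_forall fun s => by positivity)
    (intervalIntegrable_norm_output_sq hA B z _ _)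

theorem norm_outputMap_mono {τ τ' : ℝ} (hτ : 0 ≤ τ) (h : τ ≤ τ') (z : GraphDomain A.adjoint) :
    ‖outputMap hA B τ z‖ ≤ ‖outputMap hA B τ' z‖ := by
  refine (sq_le_sq₀ (norm_nonneg _) (norm_nonneg _)).1 ?_
  rw [norm_outputMap_sq hA B hτ, norm_outputMap_sq hA B (hτ.trans h)]
  exact intervalIntegral.integral_mono_interval le_rfl hτ h
    (Eventually.of_forall fun s => by positivity)
    (intervalIntegrable_norm_output_sq hA B z _ _)

/-- The output is continuous for data in `D(A*)`, so vanishing in `L²` forces its value at time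
zero, which is `B* z`, to vanish. -/
theorem controlAdjoint_eq_zero_of_outputMap {τ : ℝ} (hτ : 0 < τ) {z : GraphDomain A.adjoint}
    (hz : outputMap hA B τ z = 0) : controlAdjoint B z = 0 := by
  have h := norm_outputMap_sq hA B hτ.le z
  rw [hz, norm_zero, zero_pow two_ne_zero] at h
  by_contra hne
  refine absurd h (ne_of_lt (intervalIntegral.integral_pos hτ
    ((continuous_output hA B z).norm.pow 2).continuousOn (fun s _ => by positivity)
    ⟨0, left_mem_Icc.2 hτ.le, ?_⟩))
  rw [output, Real.toNNReal_zero, hA.adjointEvol_zero]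
  positivity

variable {hA B} in
theorem IsAdmissible.exists_norm_outputMap_le (hadm : IsAdmissible hA B) {τ : ℝ} (hτ : 0 < τ) :
    ∃ C : ℝ, ∀ z, ‖outputMap hA B τ z‖ ≤ C * ‖GraphDomain.val A.adjoint z‖ := by
  obtain ⟨C, hC, h⟩ := hadm τ hτ
  refine ⟨√C, fun z => (sq_le_sq₀ (norm_nonneg _) (by positivity)).1 ?_⟩
  rw [← integral_adjointState hA B hτ.le, mul_pow, Real.sq_sqrt hC.le]
  exact h z

end Observation

/-! ### Compactness from the weakened observability estimate -/

/-- The compactness step of a Peetre-type argument. -/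
theorem exists_subseq_tendsto_of_compact_estimate {D H G E₁ E₂ : Type*} [AddCommGroup D]
    [Module ℂ D] [NormedAddCommGroup H] [NormedSpace ℂ H] [CompleteSpace H]
    [NormedAddCommGroup G] [NormedSpace ℂ G] [NormedAddCommGroup E₁] [NormedSpace ℂ E₁]
    [NormedAddCommGroup E₂] [NormedSpace ℂ E₂] (a : D →ₗ[ℂ] H) (Φ : D →ₗ[ℂ] G)
    (P : E₁ →L[ℂ] E₂) (hP : IsCompactOperator P) (L : D →ₗ[ℂ] E₁) {C : ℝ} (hC : 0 < C)
    (h₁ : ∀ z, ‖a z‖ ^ 2 ≤ C * (‖Φ z‖ ^ 2 + ‖P (L z)‖ ^ 2))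
    (h₂ : ∀ z, ‖L z‖ ^ 2 ≤ C * (‖a z‖ ^ 2 + ‖Φ z‖ ^ 2))
    (z : ℕ → D) {M : ℝ} (hM : ∀ n, ‖a (z n)‖ ≤ M)
    (h₀ : Tendsto (fun n => Φ (z n)) atTop (𝓝 0)) :
    ∃ (x : H) (φ : ℕ → ℕ), StrictMono φ ∧ Tendsto (fun n => a (z (φ n))) atTop (𝓝 x) := by
  obtain ⟨K, hK⟩ := (Metric.isBounded_range_of_tendsto _ h₀).exists_norm_le
  have hL : ∀ n, ‖L (z n)‖ ≤ √(C * (M ^ 2 + K ^ 2)) := fun n => by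
    refine Real.le_sqrt_of_sq_le ((h₂ (z n)).trans ?_)
    have h3 := hM n
    have h4 := hK _ (mem_range_self n)
    gcongr
  -- The second estimate bounds `L zₙ`, so `P L zₙ` converges along a subsequence. The first
  -- estimate, applied to differences, then makes the states Cauchy.
  obtain ⟨e, -, φ, hφ, hlim⟩ := (hP.isCompact_closure_image_closedBall
    (f := (P : E₁ →ₗ[ℂ] E₂)) (√(C * (M ^ 2 + K ^ 2)))).tendsto_subseq
    (x := fun n => P (L (z n))) fun n => subset_closure
      ⟨L (z n), mem_closedBall_zero_iff.2 (hL n), rfl⟩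
  have hc₁ := cauchySeq_iff_tendsto_dist_atTop_0.1 hlim.cauchySeq
  have hc₂ := cauchySeq_iff_tendsto_dist_atTop_0.1 (h₀.comp hφ.tendsto_atTop).cauchySeq
  have hc : CauchySeq fun n => a (z (φ n)) := by
    rw [cauchySeq_iff_tendsto_dist_atTop_0]
    have hlim0 : Tendsto (fun n : ℕ × ℕ => √(C * (dist (Φ (z (φ n.1))) (Φ (z (φ n.2))) ^ 2 +
        dist (P (L (z (φ n.1)))) (P (L (z (φ n.2)))) ^ 2))) atTop (𝓝 0) := by
      have := (((hc₂.pow 2).add (hc₁.pow 2)).const_mul C).sqrt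
      simpa using this
    refine squeeze_zero (fun n => dist_nonneg) (fun n => Real.le_sqrt_of_sq_le ?_) hlim0
    simpa only [dist_eq_norm, map_sub] using h₁ (z (φ n.1) - z (φ n.2))
  obtain ⟨x, hx⟩ := cauchySeq_tendsto_of_complete hc
  exact ⟨x, φ, hφ, hx⟩

/-! ### The asymptotic kernel and observability -/

section Observability

variable {H : Type*} [NormedAddCommGroup H] [InnerProductSpace ℂ H] [CompleteSpace H]
  {U : Type*} [NormedAddCommGroup U] [InnerProductSpace ℂ U] [CompleteSpace U]
  {S : C0Semigroup H} {A : H →ₗ.[ℂ] H} (hA : S.IsGenerator A)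
  (B : U →L[ℂ] AntiDual (GraphDomain A.adjoint))

/-- The state `S(r)* z` reached at time `r`, for `z ∈ D(A*)`. -/
def stateMap (r : ℝ≥0) : GraphDomain A.adjoint →ₗ[ℂ] H :=
  (GraphDomain.val A.adjoint).comp (hA.adjointEvol r)

theorem stateMap_apply (r : ℝ≥0) (z : GraphDomain A.adjoint) :
    stateMap hA r z = hA.adjointSemigroup.op r (GraphDomain.val A.adjoint z) := rfl

theorem stateMap_add (s r : ℝ≥0) (z : GraphDomain A.adjoint) :
    stateMap hA (s + r) z = hA.adjointSemigroup.op s (stateMap hA r z) :=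
  hA.adjointSemigroup.op_add_apply s r _

theorem stateMap_adjointEvol (r σ : ℝ≥0) (z : GraphDomain A.adjoint) :
    stateMap hA r (hA.adjointEvol σ z) = hA.adjointSemigroup.op σ (stateMap hA r z) :=
  hA.adjointSemigroup.op_comm_apply r σ _

/-- The limits of the states `S(r)* zₙ` along sequences whose outputs on `(0, T)` tend to zero. -/
def asymptoticKernel (r : ℝ≥0) (T : ℝ) : Submodule ℂ H :=
  (LinearMap.range ((stateMap hA r).prod (outputMap hA B T))).topologicalClosure.comap
    (LinearMap.inl ℂ H (Lp U 2 (volume : Measure ℝ)))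

variable {hA B}

theorem mem_asymptoticKernel {r : ℝ≥0} {T : ℝ} {w : H} :
    w ∈ asymptoticKernel hA B r T ↔
      ∀ ε > 0, ∃ z, ‖w - stateMap hA r z‖ < ε ∧ ‖outputMap hA B T z‖ < ε := by
  rw [asymptoticKernel, Submodule.mem_comap, ← SetLike.mem_coe, Submodule.topologicalClosure_coe,
    LinearMap.coe_range, Metric.mem_closure_range_iff]
  simp [dist_eq_norm]

theorem mem_asymptoticKernel_of_tendsto {r : ℝ≥0} {T : ℝ} {w : H}
    {z : ℕ → GraphDomain A.adjoint}
    (h₁ : Tendsto (fun n => stateMap hA r (z n)) atTop (𝓝 w))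
    (h₂ : Tendsto (fun n => outputMap hA B T (z n)) atTop (𝓝 0)) :
    w ∈ asymptoticKernel hA B r T :=
  mem_closure_of_tendsto (h₁.prodMk_nhds h₂) (Eventually.of_forall fun n => ⟨z n, rfl⟩)

theorem exists_seq_of_mem_asymptoticKernel {r : ℝ≥0} {T : ℝ} {w : H}
    (hw : w ∈ asymptoticKernel hA B r T) (n : ℕ) :
    ∃ z, ‖w - stateMap hA r z‖ < 1 / ((n : ℝ) + 1) ∧
      ‖outputMap hA B T z‖ < 1 / ((n : ℝ) + 1) :=
  mem_asymptoticKernel.1 hw _ (by positivity)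

theorem isClosed_asymptoticKernel (r : ℝ≥0) (T : ℝ) :
    IsClosed (asymptoticKernel hA B r T : Set H) :=
  (Submodule.isClosed_topologicalClosure _).preimage
    (ContinuousLinearMap.inl ℂ H (Lp U 2 (volume : Measure ℝ))).continuous

theorem asymptoticKernel_anti (r : ℝ≥0) {T T' : ℝ} (hT : 0 ≤ T) (h : T ≤ T') :
    asymptoticKernel hA B r T' ≤ asymptoticKernel hA B r T := by
  intro w hw
  rw [mem_asymptoticKernel] at hw ⊢
  intro ε hε
  obtain ⟨z, h₁, h₂⟩ := hw ε hε
  exact ⟨z, h₁, (norm_outputMap_mono hA B hT h z).trans_lt h₂⟩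

/-- Evolve the approximating data by `σ`: the states move by `S(σ)*`, and the outputs remain small
on a window shortened by `σ`. -/
theorem op_mem_asymptoticKernel {r σ : ℝ≥0} {T T' : ℝ} (hT : 0 ≤ T) (h : T + σ ≤ T') {w : H}
    (hw : w ∈ asymptoticKernel hA B r T') :
    hA.adjointSemigroup.op σ w ∈ asymptoticKernel hA B r T := by
  choose z hz₁ hz₂ using exists_seq_of_mem_asymptoticKernel hw
  have hσ := σ.coe_nonneg
  refine mem_asymptoticKernel_of_tendsto (z := fun n => hA.adjointEvol σ (z n)) ?_ ?_
  · simp only [stateMap_adjointEvol]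
    refine ((hA.adjointSemigroup.op σ).continuous.tendsto w).comp ?_
    rw [tendsto_iff_norm_sub_tendsto_zero]
    refine squeeze_zero (fun n => norm_nonneg _) (fun n => ?_) tendsto_one_div_add_atTop_nhds_zero_nat
    rw [norm_sub_rev]
    exact (hz₁ n).le
  · refine squeeze_zero_norm (fun n => ?_) tendsto_one_div_add_atTop_nhds_zero_nat
    exact ((norm_outputMap_adjointEvol_le hA B hT σ _).trans
      (norm_outputMap_mono hA B (by positivity) h _)).trans (hz₂ n).le

variable (hA B) in
/-- Bounded sequences of states at time `r` with outputs tending to zero have convergent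
subsequences. -/
def IsAsymptoticallyCompact (r : ℝ≥0) : Prop :=
  ∀ (z : ℕ → GraphDomain A.adjoint) (M : ℝ), (∀ n, ‖stateMap hA r (z n)‖ ≤ M) →
    Tendsto (fun n => outputMap hA B r (z n)) atTop (𝓝 0) →
    ∃ (x : H) (φ : ℕ → ℕ), StrictMono φ ∧ Tendsto (fun n => stateMap hA r (z (φ n))) atTop (𝓝 x)

theorem tendsto_outputMap_of_le {T : ℝ} {r : ℝ≥0} (hr : r ≤ T) {z : ℕ → GraphDomain A.adjoint}
    {b : ℕ → ℝ} (hz : ∀ n, ‖outputMap hA B T (z n)‖ ≤ b n) (hb : Tendsto b atTop (𝓝 0)) :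
    Tendsto (fun n => outputMap hA B r (z n)) atTop (𝓝 0) :=
  squeeze_zero_norm (fun n => (norm_outputMap_mono hA B r.coe_nonneg hr _).trans (hz n)) hb

/-- By Riesz, it suffices that the closed unit ball is compact. Each of its elements `wₙ` is within
`1 / (n + 1)` of a state with small output, so a convergent subsequence of these states carries `wₙ`
along. -/
theorem IsAsymptoticallyCompact.finiteDimensional {r : ℝ≥0} (hr : IsAsymptoticallyCompact hA B r)
    {T : ℝ} (hT : r ≤ T) : FiniteDimensional ℂ (asymptoticKernel hA B r T) := by
  refine FiniteDimensional.of_isCompact_closedBall₀ ℂ one_pos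
    (isCompact_iff_isSeqCompact.2 fun w hw => ?_)
  choose z hz₁ hz₂ using fun n => exists_seq_of_mem_asymptoticKernel (w n).2 n
  have hM : ∀ n, ‖stateMap hA r (z n)‖ ≤ 2 := fun n => by
    have h1 : ‖(w n : H)‖ ≤ 1 := by simpa using hw n
    have h2 : 1 / ((n : ℝ) + 1) ≤ 1 := by
      rw [div_le_one (by positivity)]; linarith [n.cast_nonneg (α := ℝ)]
    have h3 := norm_sub_norm_le (stateMap hA r (z n)) (w n : H)
    rw [norm_sub_rev] at h3
    linarith [hz₁ n]
  obtain ⟨x, φ, hφ, hx⟩ := hr z 2 hM (tendsto_outputMap_of_le hT (fun n => (hz₂ n).le)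
    tendsto_one_div_add_atTop_nhds_zero_nat)
  have hwx : Tendsto (fun n => (w (φ n) : H)) atTop (𝓝 x) := by
    have h0 : Tendsto (fun n => (w n : H) - stateMap hA r (z n)) atTop (𝓝 0) :=
      squeeze_zero_norm (fun n => (hz₁ n).le) tendsto_one_div_add_atTop_nhds_zero_nat
    simpa using (h0.comp hφ.tendsto_atTop).add hx
  have hxmem : x ∈ asymptoticKernel hA B r T :=
    (isClosed_asymptoticKernel r T).mem_of_tendsto hwx (Eventually.of_forall fun n => (w (φ n)).2)
  have hwx' : Tendsto (w ∘ φ) atTop (𝓝 ⟨x, hxmem⟩) := tendsto_subtype_rng.2 hwx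
  exact ⟨⟨x, hxmem⟩, Metric.isClosed_closedBall.mem_of_tendsto hwx'
    (Eventually.of_forall fun n => hw (φ n)), φ, hφ, hwx'⟩

theorem IsAsymptoticallyCompact.exists_bound {r : ℝ≥0} (hr : IsAsymptoticallyCompact hA B r)
    {T : ℝ} (hT : r ≤ T) (h : asymptoticKernel hA B r T = ⊥) :
    ∃ C : ℝ, ∀ z, ‖stateMap hA r z‖ ≤ C * ‖outputMap hA B T z‖ := by
  by_contra! hcon
  -- Counterexamples to the constants `n + 1` are normalised to unit states; a limit point is then a
  -- unit vector of the asymptotic kernel.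
  have hseq : ∀ n : ℕ, ∃ z, ‖stateMap hA r z‖ = 1 ∧ ‖outputMap hA B T z‖ ≤ 1 / ((n : ℝ) + 1) := by
    intro n
    obtain ⟨z, hz⟩ := hcon ((n : ℝ) + 1)
    have hpos : 0 < ‖stateMap hA r z‖ := lt_of_le_of_lt (by positivity) hz
    refine ⟨((‖stateMap hA r z‖⁻¹ : ℝ) : ℂ) • z, ?_, ?_⟩
    · rw [map_smul, norm_smul, Complex.norm_real, norm_inv, norm_norm, inv_mul_cancel₀ hpos.ne']
    · rw [map_smul, norm_smul, Complex.norm_real, norm_inv, norm_norm, inv_mul_le_iff₀ hpos,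
        mul_one_div, le_div_iff₀ (by positivity), mul_comm]
      exact hz.le
  choose z hz₁ hz₂ using hseq
  obtain ⟨x, φ, hφ, hx⟩ := hr z 1 (fun n => (hz₁ n).le)
    (tendsto_outputMap_of_le hT hz₂ tendsto_one_div_add_atTop_nhds_zero_nat)
  have hx1 : ‖x‖ = 1 := by
    refine tendsto_nhds_unique hx.norm ?_
    simp only [hz₁, tendsto_const_nhds_iff]
  have h0 : Tendsto (fun n => outputMap hA B T (z n)) atTop (𝓝 0) :=
    squeeze_zero_norm hz₂ tendsto_one_div_add_atTop_nhds_zero_nat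
  have hmem := mem_asymptoticKernel_of_tendsto hx (h0.comp hφ.tendsto_atTop)
  rw [h, Submodule.mem_bot] at hmem
  simp [hmem] at hx1

theorem asymptoticKernel_eq_bot (hadm : IsAdmissible hA B) (hFH : FattoriniHautus A B)
    {r : ℝ≥0} (hr : IsAsymptoticallyCompact hA B r) {T : ℝ} (hT : r < T) :
    asymptoticKernel hA B r T = ⊥ := by
  by_contra hne
  let d : ℝ → ℕ := fun t => Module.finrank ℂ (asymptoticKernel hA B r t)
  have hne' : (Ioo (r : ℝ) T).Nonempty := nonempty_Ioo.2 hT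
  -- Minimal dimension at `T₁` makes the decreasing family constant from `T₁` to any `T₂ < T`, which
  -- yields invariance up to time `T₂ - T₁`. Taking `T₁ > r` leaves the window `(0, T₁ - r)` for the
  -- output of the eigenvector.
  obtain ⟨T₁, hT₁, hmin⟩ : ∃ T₁ ∈ Ioo (r : ℝ) T, ∀ t ∈ Ioo (r : ℝ) T, d T₁ ≤ d t :=
    ⟨Function.argminOn d _ hne', Function.argminOn_mem d _ hne',
      fun t ht => Function.argminOn_le d _ ht⟩
  obtain ⟨T₂, hT₁₂, hT₂⟩ := exists_between hT₁.2
  have hr0 := r.coe_nonneg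
  have hT₁0 : 0 ≤ T₁ := hr0.trans hT₁.1.le
  have := hr.finiteDimensional hT₁.1.le
  have heq : asymptoticKernel hA B r T₂ = asymptoticKernel hA B r T₁ :=
    Submodule.eq_of_le_of_finrank_le (asymptoticKernel_anti r hT₁0 hT₁₂.le)
      (hmin T₂ ⟨hT₁.1.trans hT₁₂, hT₂⟩)
  have hV : asymptoticKernel hA B r T₁ ≠ ⊥ := fun h0 =>
    hne (eq_bot_iff.2 ((asymptoticKernel_anti r hT₁0 hT₁.2.le).trans h0.le))
  obtain ⟨z, μ, hz, hzV, hμ⟩ := hA.exists_eigenvector _ hV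
    (δ := (T₂ - T₁).toNNReal) (Real.toNNReal_pos.2 (sub_pos.2 hT₁₂)) fun σ hσ v hv => by
      rw [← heq] at hv
      refine op_mem_asymptoticKernel hT₁0 ?_ hv
      have := (Real.le_toNNReal_iff_coe_le (sub_nonneg.2 hT₁₂.le)).1 hσ
      linarith
  have hε : 0 < T₁ - r := sub_pos.2 hT₁.1
  obtain ⟨C, hC⟩ := hadm.exists_norm_outputMap_le hε
  -- Approximate `z` by `S(r)* xₙ`. Admissibility controls the output of the difference, and the
  -- output of `S(r)* xₙ` on `(0, T₁ - r)` is that of `xₙ` on `(r, T₁)`, which tends to zero.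
  have hΦ : outputMap hA B (T₁ - r) z = 0 := by
    rw [← norm_le_zero_iff]
    choose x hx₁ hx₂ using exists_seq_of_mem_asymptoticKernel hzV
    have hle : ∀ n : ℕ, ‖outputMap hA B (T₁ - r) z‖ ≤ (|C| + 1) * (1 / ((n : ℝ) + 1)) := fun n => by
      have h1 := hC (z - hA.adjointEvol r (x n))
      have h2 := norm_outputMap_adjointEvol_le hA B hε.le r (x n)
      rw [sub_add_cancel] at h2
      have h3 : ‖GraphDomain.val A.adjoint (z - hA.adjointEvol r (x n))‖ ≤ 1 / ((n : ℝ) + 1) := by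
        rw [map_sub]; exact (hx₁ n).le
      have h4 : ‖outputMap hA B (T₁ - r) z‖ ≤ ‖outputMap hA B (T₁ - r) (z - hA.adjointEvol r (x n))‖
          + ‖outputMap hA B (T₁ - r) (hA.adjointEvol r (x n))‖ := by
        rw [map_sub]; exact norm_le_norm_sub_add _ _
      have h5 : C * ‖GraphDomain.val A.adjoint (z - hA.adjointEvol r (x n))‖ ≤
          |C| * (1 / ((n : ℝ) + 1)) :=
        mul_le_mul (le_abs_self C) h3 (norm_nonneg _) (abs_nonneg C)
      linarith [hx₂ n]
    have hlim : Tendsto (fun n : ℕ => (|C| + 1) * (1 / ((n : ℝ) + 1))) atTop (𝓝 0) := by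
      simpa using tendsto_one_div_add_atTop_nhds_zero_nat.const_mul (|C| + 1)
    exact ge_of_tendsto' hlim hle
  have hmem : z ∈ LinearMap.ker (μ • GraphDomain.val A.adjoint - GraphDomain.app A.adjoint) ⊓
      LinearMap.ker (controlAdjoint B).toLinearMap :=
    ⟨by simp [hμ], controlAdjoint_eq_zero_of_outputMap hA B hε hΦ⟩
  rw [hFH μ] at hmem
  exact hz hmem

/-- The observability inequality at time `T`. -/
theorem exists_observability (hadm : IsAdmissible hA B) (hFH : FattoriniHautus A B)
    {r T : ℝ≥0} (hr : IsAsymptoticallyCompact hA B r) (hT : r < T) :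
    ∃ C : ℝ, ∀ z, ‖stateMap hA T z‖ ≤ C * ‖outputMap hA B T z‖ := by
  have hT' : (r : ℝ) < T := NNReal.coe_lt_coe.2 hT
  obtain ⟨C, hC⟩ := hr.exists_bound hT'.le (asymptoticKernel_eq_bot hadm hFH hr hT')
  refine ⟨‖hA.adjointSemigroup.op (T - r)‖ * C, fun z => ?_⟩
  rw [← tsub_add_cancel_of_le hT.le, stateMap_add, tsub_add_cancel_of_le hT.le, mul_assoc]
  exact (ContinuousLinearMap.le_opNorm _ _).trans (by gcongr; exact hC z)

end Observability

/-! ### Duality and construction of the control -/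

/-- A bounded adjoint for a densely dominated operator. -/
theorem exists_clm_inner_eq {D H G : Type*} [AddCommGroup D] [Module ℂ D]
    [NormedAddCommGroup H] [InnerProductSpace ℂ H] [CompleteSpace H]
    [NormedAddCommGroup G] [InnerProductSpace ℂ G] [CompleteSpace G]
    (e : D →ₗ[ℂ] G) (f : D →ₗ[ℂ] H) (he : DenseRange e) {C : ℝ} (h : ∀ z, ‖f z‖ ≤ C * ‖e z‖) :
    ∃ K : H →L[ℂ] G, ∀ z y, inner ℂ (e z) (K y) = inner ℂ (f z) y := by
  refine ⟨ContinuousLinearMap.adjoint (f.extendOfNorm e), fun z y => ?_⟩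
  rw [ContinuousLinearMap.adjoint_inner_right, LinearMap.extendOfNorm_eq he ⟨C, h⟩]

/-- Duality between a domination of linear maps and the inclusion of the ranges of their
adjoints. -/
theorem exists_inner_eq_of_norm_le {D H G : Type*} [AddCommGroup D] [Module ℂ D]
    [NormedAddCommGroup H] [InnerProductSpace ℂ H] [CompleteSpace H]
    [NormedAddCommGroup G] [InnerProductSpace ℂ G] [CompleteSpace G]
    (e : D →ₗ[ℂ] G) (f : D →ₗ[ℂ] H) {C : ℝ} (h : ∀ z, ‖f z‖ ≤ C * ‖e z‖) (y : H) :
    ∃ w : G, ∀ z, inner ℂ (e z) w = inner ℂ (f z) y := by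
  -- The range of `e` need not be dense in `G`, so the bounded extension is made on its closure.
  set M := (LinearMap.range e).topologicalClosure
  let e' : D →ₗ[ℂ] M :=
    e.codRestrict M fun z => Submodule.le_topologicalClosure _ (LinearMap.mem_range_self e z)
  have he' : DenseRange e' := by
    intro x
    rw [closure_subtype, ← range_comp]
    exact x.2
  have : CompleteSpace M :=
    (Submodule.isClosed_topologicalClosure (LinearMap.range e)).completeSpace_coe
  obtain ⟨K, hK⟩ := exists_clm_inner_eq e' f he' h
  exact ⟨K y, fun z => hK z y⟩

/-- Continuity of translations in `L²` is what makes the controlled trajectory continuous in time.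
-/
theorem continuous_compMeasurePreserving_add_right {E : Type*} [NormedAddCommGroup E]
    (v : Lp E 2 (volume : Measure ℝ)) :
    Continuous fun a : ℝ => Lp.compMeasurePreserving (fun s => s + a)
      (measurePreserving_add_right volume a) v := by
  let g : C(ℝ, C(ℝ, ℝ)) :=
    (ContinuousMap.mk (fun p : ℝ × ℝ => p.2 + p.1) (by fun_prop)).curry
  exact (continuous_const (y := v)).compMeasurePreservingLp g.continuous
    (fun a => measurePreserving_add_right volume a) ENNReal.ofNat_ne_top

section Duality

variable {H : Type*} [NormedAddCommGroup H] [InnerProductSpace ℂ H] [CompleteSpace H]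
  {U : Type*} [NormedAddCommGroup U] [InnerProductSpace ℂ U] [CompleteSpace U]
  {S : C0Semigroup H} {A : H →ₗ.[ℂ] H} {hA : S.IsGenerator A}
  {B : U →L[ℂ] AntiDual (GraphDomain A.adjoint)}

/-- An observability inequality for the adjoint system yields null controllability. -/
theorem isNullControllable_of_observability (hadm : IsAdmissible hA B) {T : ℝ} (hT : 0 < T)
    {C : ℝ} (hobs : ∀ z, ‖stateMap hA T.toNNReal z‖ ≤ C * ‖outputMap hA B T z‖) :
    IsNullControllable hA B T := by
  intro y₀
  -- The sign of `-y₀` makes the effect of the control at time `T` cancel the free evolution `S(T)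
  -- y₀`.
  obtain ⟨w, hw⟩ := exists_inner_eq_of_norm_le (outputMap hA B T) (stateMap hA T.toNNReal)
    hobs (-y₀)
  obtain ⟨C', hC'⟩ := hadm.exists_norm_outputMap_le hT
  obtain ⟨K, hK⟩ := exists_clm_inner_eq (GraphDomain.val A.adjoint) (outputMap hA B T)
    hA.denseRange_val hC'
  -- Truncation makes the translate by `T - τ` vanish on `(τ, T]`, so the single operator `K` for
  -- the horizon `T` serves every `τ ≤ T`.
  have hwL : MemLp ((Ioc 0 T).indicator w) 2 (volume : Measure ℝ) :=
    (Lp.memLp w).indicator measurableSet_Ioc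
  set v := hwL.toLp with hv
  have hvw : v =ᵐ[volume] (Ioc 0 T).indicator w := hwL.coeFn_toLp
  -- Outputs are indexed by the time elapsed backwards, hence the reflection; the translate of `w`
  -- at `s` is then `u (τ - s)`.
  let u : ℝ → U := fun t => (Ioc 0 T).indicator w (T - t)
  let y : ℝ → H := fun τ => S.op τ.toNNReal y₀ +
    K (Lp.compMeasurePreserving (fun s => s + (T - τ)) (measurePreserving_add_right volume (T - τ)) v)
  have hy : Continuous y := (S.continuous_op_toNNReal y₀).add (K.continuous.comp
    ((continuous_compMeasurePreserving_add_right v).comp (continuous_const.sub continuous_id)))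
  have hu : MemLp u 2 (volume : Measure ℝ) :=
    hwL.comp_measurePreserving (Measure.measurePreserving_sub_left volume T)
  have h4 : ∀ τ : ℝ, ∀ᵐ s ∂volume, (Lp.compMeasurePreserving (fun s => s + (T - τ))
      (measurePreserving_add_right volume (T - τ)) v) s =
      (Ioc 0 T).indicator w (s + (T - τ)) := by
    intro τ
    filter_upwards [Lp.coeFn_compMeasurePreserving v
      (measurePreserving_add_right volume (T - τ)),
      (measurePreserving_add_right volume (T - τ)).quasiMeasurePreserving.ae hvw] with s hs hs'
    rw [hs, Function.comp_apply, hs']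
  have hsol : ∀ τ ∈ Ioc 0 T, ∀ z : GraphDomain A.adjoint,
      inner ℂ (GraphDomain.val A.adjoint z) (y τ)
          - inner ℂ (GraphDomain.val A.adjoint (adjointState hA τ z 0)) y₀
        = ∫ t in (0 : ℝ)..τ, inner ℂ (controlAdjoint B (adjointState hA τ z t)) (u t) := by
    intro τ hτ z
    have h1 : inner ℂ (GraphDomain.val A.adjoint (adjointState hA τ z 0)) y₀ =
        inner ℂ (GraphDomain.val A.adjoint z) (S.op τ.toNNReal y₀) := by
      rw [hA.adjointState_eq, hA.val_adjointEvol, hA.inner_adjointSemigroup, sub_zero]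
    have h2 : ∫ t in (0 : ℝ)..τ, inner ℂ (controlAdjoint B (adjointState hA τ z t)) (u t) =
        ∫ s in (0 : ℝ)..τ, inner ℂ (output hA B z s) ((Ioc 0 T).indicator w (s + (T - τ))) := by
      have h3 := intervalIntegral.integral_comp_sub_left (a := 0) (b := τ)
        (fun s => inner ℂ (output hA B z s) ((Ioc 0 T).indicator w (s + (T - τ)))) τ
      rw [sub_self, sub_zero] at h3
      rw [← h3]
      refine intervalIntegral.integral_congr fun t _ => ?_
      simp only [controlAdjoint_adjointState, u]
      congr 2
      ring
    rw [h1, h2, inner_add_right, add_sub_cancel_left, hK, inner_outputMap hA B hT.le,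
      intervalIntegral.integral_of_le hT.le, intervalIntegral.integral_of_le hτ.1.le]
    rw [← setIntegral_eq_of_subset_of_forall_sdiff_eq_zero measurableSet_Ioc
      (Ioc_subset_Ioc_right hτ.2) fun s hs => ?_]
    · exact integral_congr_ae (ae_restrict_of_ae ((h4 τ).mono fun s hs => by simp only [hs]))
    · have h5 : s + (T - τ) ∉ Ioc 0 T := fun h => hs.2 ⟨hs.1.1, by linarith [h.2]⟩
      rw [indicator_of_notMem h5, inner_zero_right]
  refine ⟨u, hu.restrict _, y, ⟨hy.continuousOn, hsol⟩, ?_⟩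
  refine hA.denseRange_val.eq_zero_of_inner_right ℂ fun z => ?_
  have h5 : inner ℂ (outputMap hA B T z) (Lp.compMeasurePreserving (fun s => s + (T - T))
      (measurePreserving_add_right volume (T - T)) v) = inner ℂ (outputMap hA B T z) w := by
    rw [inner_outputMap hA B hT.le, inner_outputMap hA B hT.le,
      intervalIntegral.integral_of_le hT.le, intervalIntegral.integral_of_le hT.le]
    refine integral_congr_ae ?_
    filter_upwards [ae_restrict_of_ae (h4 T), ae_restrict_mem measurableSet_Ioc] with s hs hs'
    rw [hs, sub_self, add_zero, indicator_of_mem hs']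
  rw [inner_add_right, hK, h5, hw, inner_neg_right, stateMap_apply, hA.inner_adjointSemigroup,
    add_neg_cancel]

end Duality

end

/-! ### Conclusion -/

theorem theorem6p6
    {H : Type uH} [NormedAddCommGroup H] [InnerProductSpace ℂ H] [CompleteSpace H]
    {U : Type uU} [NormedAddCommGroup U] [InnerProductSpace ℂ U] [CompleteSpace U]
    (S : C0Semigroup H) (A : H →ₗ.[ℂ] H) (hA : S.IsGenerator A)
    (B : U →L[ℂ] AntiDual (GraphDomain A.adjoint))
    (hadm : IsAdmissible hA B)
    (hFH : FattoriniHautus A B)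
    (T₀ : ℝ) (hT₀ : 0 < T₀)
    (hobs : ∀ T : ℝ, T₀ < T →
      ∃ (E₁ : Type w₁) (_ : NormedAddCommGroup E₁) (_ : NormedSpace ℂ E₁) (_ : CompleteSpace E₁)
        (E₂ : Type w₂) (_ : NormedAddCommGroup E₂) (_ : NormedSpace ℂ E₂) (_ : CompleteSpace E₂)
        (P : E₁ →L[ℂ] E₂) (L : GraphDomain A.adjoint →ₗ[ℂ] E₁) (C : ℝ),
        IsCompactOperator P ∧ 0 < C ∧
        ∀ z₁ : GraphDomain A.adjoint,
          ‖GraphDomain.val A.adjoint (adjointState hA T z₁ 0)‖ ^ 2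
            ≤ C * ((∫ t in (0 : ℝ)..T, ‖controlAdjoint B (adjointState hA T z₁ t)‖ ^ 2)
                + ‖P (L z₁)‖ ^ 2) ∧
          ‖L z₁‖ ^ 2
            ≤ C * (‖GraphDomain.val A.adjoint (adjointState hA T z₁ 0)‖ ^ 2
                + ∫ t in (0 : ℝ)..T, ‖controlAdjoint B (adjointState hA T z₁ t)‖ ^ 2))
    (hback : ∀ T : ℝ, T₀ < T → ∀ t₁ t₂ : ℝ, 0 < t₁ → t₁ < t₂ → t₂ < T - T₀ →
      ∃ C : ℝ, 0 < C ∧ ∀ z₁ : GraphDomain A.adjoint,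
        ‖GraphDomain.val A.adjoint (adjointState hA T z₁ t₂)‖ ^ 2
          ≤ C * (‖GraphDomain.val A.adjoint (adjointState hA T z₁ t₁)‖ ^ 2
              + ∫ t in t₁..t₂, ‖controlAdjoint B (adjointState hA T z₁ t)‖ ^ 2)) :
    ∀ T : ℝ, T₀ < T → IsNullControllable hA B T := by
  intro T hT
  have hT0 : 0 < T := hT₀.trans hT
  -- The estimate is used at an `r` strictly below `T`; the slack `T - r` is what the dimension
  -- argument for the asymptotic kernel needs.
  obtain ⟨r, hr₀, hrT⟩ := exists_between hT
  have hr0 : 0 < r := hT₀.trans hr₀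
  have hstate : ∀ z, GraphDomain.val A.adjoint (adjointState hA r z 0) =
      stateMap hA r.toNNReal z := fun z => by
    rw [hA.adjointState_eq, sub_zero]; rfl
  obtain ⟨E₁, _, _, _, E₂, _, _, _, P, L, C, hP, hC, hest⟩ := hobs r hr₀
  simp only [integral_adjointState hA B hr0.le, hstate] at hest
  have hcomp : IsAsymptoticallyCompact hA B r.toNNReal := by
    intro z M hM h₀
    rw [Real.coe_toNNReal r hr0.le] at h₀
    exact exists_subseq_tendsto_of_compact_estimate (stateMap hA r.toNNReal) (outputMap hA B r)
      P hP L hC (fun z => (hest z).1) (fun z => (hest z).2) z hM h₀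
  obtain ⟨C', hC'⟩ := exists_observability hadm hFH hcomp (T := T.toNNReal)
    ((Real.toNNReal_lt_toNNReal_iff hT0).2 hrT)
  rw [Real.coe_toNNReal T hT0.le] at hC'
  exact isNullControllable_of_observability hadm hT0 hC'
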